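/- Let $A$ be a unital $C^*$-algebra, let $E\subseteq A$ be an operator space, i.e. a norm-closed linear subspace of $A$, let $K$ be a complex Hilbert space and let $u:E\to B(K)$ be a linear map. For $n\ge 1$ let $M_n(E)\subseteq M_n(A)$ be the space of $n\times n$ matrices with entries in $E$, with the norm and the positive elements inherited from the $C^*$-algebra $M_n(A)$, let $u_n:M_n(E)\to M_n(B(K))=B(K^{(n)})$ be the map $u_n([a_{ij}])=[u(a_{ij})]$, and let $\|u\|_{cb}=\sup_{n\ge1}\|u_n\|\in[0,\infty]$. The map $u$ is completely bounded if $\|u\|_{cb}<\infty$. (1) The following conditions are equivalent: (i) $u$ is completely bounded and $\|u\|_{cb}\le 1$; (ii) there are a complex Hilbert space $\hat H$, a unital $*$-representation $\pi:A\to B(\hat H)$ and linear maps $V,W:K\to\hat H$ with $\|V\|\le1$ and $\|W\|\le 1$ such that $u(a)=V^*\pi(a)W$ for all $a\in E$. (2) Suppose moreover that $E$ is an operator system, i.e. $1\in E$, and $x^*\in E$ for every $x\in E$. Call $u$ completely positive if for every $n\ge 1$ the map $u_n$ sends positive elements of $M_n(A)$ lying in $M_n(E)$ to positive elements of $M_n(B(K))$.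 Then (a) $u$ is completely positive if and only if there are a complex Hilbert space $\hat H$, a unital $*$-representation $\pi:A\to B(\hat H)$ and a bounded linear map $V:K\to\hat H$ such that $u(a)=V^*\pi(a)V$ for all $a\in E$; (b) $u$ is completely positive with $\|u\|_{cb}\le1$ if and only if there is such a factorisation with $\|V\|\le 1$. -/

import Mathlib

open scoped ENNReal

universe uA uK w

noncomputable section

/-- A closed linear subspace of a C⋆-algebra `A`, seen as a concrete operator space. -/
def IsOperatorSpace {A : Type*} [CStarAlgebra A] (E : Submodule ℂ A) : Prop :=
  IsClosed (E : Set A)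

/-- A closed linear subspace of a unital C⋆-algebra which contains the unit and is closed
under the involution. -/
structure IsOperatorSystem {A : Type*} [CStarAlgebra A] (S : Submodule ℂ A) : Prop where
  isClosed : IsClosed (S : Set A)
  one_mem : (1 : A) ∈ S
  star_mem : ∀ x ∈ S, star x ∈ S

section

variable {A B : Type*} [CStarAlgebra A] [PartialOrder A] [StarOrderedRing A]
  [CStarAlgebra B] [PartialOrder B] [StarOrderedRing B]

/-- `M_n(E)`: the matrices over the C⋆-algebra `A` whose entries lie in the subspace `E`.
As a subspace of `CStarMatrix (Fin n) (Fin n) A` it carries the norm and the order of the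
C⋆-algebra `M_n(A)`. -/
def matrixSpace (E : Submodule ℂ A) (n : ℕ) :
    Submodule ℂ (CStarMatrix (Fin n) (Fin n) A) where
  carrier := {x | ∀ i j, x i j ∈ E}
  add_mem' hx hy i j := E.add_mem (hx i j) (hy i j)
  zero_mem' _ _ := E.zero_mem
  smul_mem' c _ hx i j := E.smul_mem c (hx i j)

/-- The amplification `u_n : M_n(E) → M_n(B)`, `[a i j] ↦ [u (a i j)]`. -/
def amplification {E : Submodule ℂ A} (u : E →ₗ[ℂ] B) (n : ℕ) :
    matrixSpace E n →ₗ[ℂ] CStarMatrix (Fin n) (Fin n) B where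
  toFun x := CStarMatrix.ofMatrix fun i j => u ⟨x.1 i j, x.2 i j⟩
  map_add' x y := CStarMatrix.ext fun i j =>
    u.map_add ⟨x.1 i j, x.2 i j⟩ ⟨y.1 i j, y.2 i j⟩
  map_smul' c x := CStarMatrix.ext fun i j => u.map_smul c ⟨x.1 i j, x.2 i j⟩

/-- The operator norm `‖u_n‖` of the `n`-th amplification, with value `∞` if `u_n` is
unbounded. -/
def amplificationNorm {E : Submodule ℂ A} (u : E →ₗ[ℂ] B) (n : ℕ) : ℝ≥0∞ :=
  ⨆ (x : matrixSpace E n) (_ : ‖x‖ ≤ 1), ‖amplification u n x‖ₑ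

/-- The completely bounded norm `‖u‖_cb = sup_{n ≥ 1} ‖u_n‖ ∈ [0, ∞]`. -/
def cbNorm {E : Submodule ℂ A} (u : E →ₗ[ℂ] B) : ℝ≥0∞ :=
  ⨆ (n : ℕ) (_ : 1 ≤ n), amplificationNorm u n

/-- `u` is completely bounded: `‖u‖_cb < ∞`. -/
def IsCompletelyBounded {E : Submodule ℂ A} (u : E →ₗ[ℂ] B) : Prop :=
  cbNorm u < ∞

/-- `u` is `n`-positive: `u_n` maps `M_n(S) ∩ M_n(A)₊` into `M_n(B)₊`. -/
def IsNPositive {S : Submodule ℂ A} (u : S →ₗ[ℂ] B) (n : ℕ) : Prop :=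
  ∀ x : matrixSpace S n, 0 ≤ (x : CStarMatrix (Fin n) (Fin n) A) → 0 ≤ amplification u n x

/-- `u` is completely positive: it is `n`-positive for every `n`. -/
def IsCompletelyPositive {S : Submodule ℂ A} (u : S →ₗ[ℂ] B) : Prop :=
  ∀ n : ℕ, IsNPositive u n

end

end

/-! Matrices over `A` act on `A`-valued sequences, so a linear functional `φ` on finitely supported
matrices that is nonnegative on Gram matrices `[star (a i) * a j]` has a GNS construction: it yields
a representation `π` and vectors `ξ i` with `φ [a at (i, j)] = ⟪ξ i, π a (ξ j)⟫`. For a completely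
positive `u`, take `K` itself as index set and `φ = ∑ ⟪k, u (·) l⟫`. This is defined on matrices
over `E` only; the Riesz extension theorem provides positivity-preserving values on all of `A`, and
`k ↦ ξ k` turns out to be linear and bounded, with norm controlled by `u 1`.

A complete contraction `u` on a mere subspace is reduced to this case by Paulsen's trick: the map
`[[λ, x], [star y, μ]] ↦ [[λ, u x], [(u y)†, μ]]` is completely positive, and compressing its
dilation to the corner `(0, 1)` gives the factorisation of `u`. Positivity of a block matrix
`[[L, x], [star x, M]]` amounts, after perturbing to invertible scalar `L` and `M`, to
`‖L^(-1/2) x M^(-1/2)‖ ≤ 1`, and the amplifications of `u` commute with multiplication by scalar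
matrices. -/

noncomputable section

open scoped InnerProductSpace ComplexConjugate ComplexOrder

section InjectiveStarHom

variable {A B : Type*} [CStarAlgebra A] [PartialOrder A] [StarOrderedRing A]
  [CStarAlgebra B] [PartialOrder B] [StarOrderedRing B]

lemma map_nonneg_iff_of_injective {φ : A →⋆ₐ[ℂ] B} (hφ : Function.Injective φ) {a : A} :
    0 ≤ φ a ↔ 0 ≤ a := by
  refine ⟨fun h => ?_, map_nonneg φ⟩
  have ha : IsSelfAdjoint a := hφ ((map_star φ a).trans (IsSelfAdjoint.of_nonneg h).star_eq)
  rw [← cfc_id ℝ a]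
  exact cfc_nonneg fun x hx => spectrum_nonneg_of_nonneg h (by rwa [ha.map_spectrum_real φ hφ])

end InjectiveStarHom

section OperatorMatrix

variable {ι H : Type*} [Fintype ι] [DecidableEq ι] [NormedAddCommGroup H] [InnerProductSpace ℂ H]
  [CompleteSpace H]

variable (ι H) in
/-- The operator on the Hilbert sum `H^ι` with matrix `y`. This is the identification
`M_ι(B(H)) = B(H^ι)`; only its injectivity is needed. -/
def operatorMatrix : CStarMatrix ι ι (H →L[ℂ] H) →⋆ₐ[ℂ]
    (PiLp 2 (fun _ : ι => H) →L[ℂ] PiLp 2 (fun _ : ι => H)) where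
  toFun y := (PiLp.continuousLinearEquiv 2 ℂ fun _ : ι => H).symm.toContinuousLinearMap ∘L
    ContinuousLinearMap.pi fun i => ∑ j, y i j ∘L PiLp.proj 2 (fun _ : ι => H) j
  map_zero' := by
    ext h i
    simp
  map_one' := by
    ext h i
    simp [CStarMatrix.one_apply, apply_ite, ite_apply]
  map_add' x y := by
    ext h i
    simp [Finset.sum_add_distrib]
  map_mul' x y := by
    ext h i
    simp only [ContinuousLinearMap.comp_apply, ContinuousLinearMap.coe_pi', sum_apply,
      PiLp.proj_apply, mul_apply_eq_comp, ContinuousLinearEquiv.coe_coe,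
      PiLp.continuousLinearEquiv_symm_apply, CStarMatrix.mul_apply, map_sum]
    exact Finset.sum_comm
  commutes' c := by
    ext h i
    simp [CStarMatrix.algebraMap_apply, apply_ite, ite_apply]
  map_star' x := by
    refine (ContinuousLinearMap.eq_adjoint_iff _ _).mpr fun g h => ?_
    simp only [PiLp.inner_apply, CStarMatrix.star_apply, ContinuousLinearMap.star_eq_adjoint,
      ContinuousLinearMap.comp_apply, ContinuousLinearMap.coe_pi', sum_apply,
      PiLp.proj_apply, ContinuousLinearEquiv.coe_coe, inner_sum, sum_inner,
      PiLp.continuousLinearEquiv_symm_apply, ContinuousLinearMap.adjoint_inner_left]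
    exact Finset.sum_comm

lemma operatorMatrix_apply (y : CStarMatrix ι ι (H →L[ℂ] H)) (h : PiLp 2 fun _ : ι => H)
    (i : ι) : operatorMatrix ι H y h i = ∑ j, y i j (h j) := by
  simp [operatorMatrix]

lemma inner_operatorMatrix (y : CStarMatrix ι ι (H →L[ℂ] H)) (g h : PiLp 2 fun _ : ι => H) :
    ⟪g, operatorMatrix ι H y h⟫_ℂ = ∑ i, ∑ j, ⟪g i, y i j (h j)⟫_ℂ := by
  simp only [PiLp.inner_apply, operatorMatrix_apply, inner_sum]

lemma operatorMatrix_injective : Function.Injective (operatorMatrix ι H) :=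
  fun x y hxy => CStarMatrix.ext fun i j => by
    ext k
    have h : ∀ z, operatorMatrix ι H z (PiLp.single 2 j k) i = z i j k := fun z => by
      simp [operatorMatrix_apply, apply_ite]
    rw [← h, hxy, h]

lemma norm_operatorMatrix (y : CStarMatrix ι ι (H →L[ℂ] H)) : ‖operatorMatrix ι H y‖ = ‖y‖ :=
  NonUnitalStarAlgHom.norm_map (operatorMatrix ι H) operatorMatrix_injective y

lemma operatorMatrix_nonneg_iff {y : CStarMatrix ι ι (H →L[ℂ] H)} :
    0 ≤ operatorMatrix ι H y ↔ 0 ≤ y :=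
  map_nonneg_iff_of_injective (B := PiLp 2 (fun _ : ι => H) →L[ℂ] PiLp 2 (fun _ : ι => H))
    operatorMatrix_injective

end OperatorMatrix

section MatrixForm

variable {ι H : Type*} [Fintype ι] [NormedAddCommGroup H] [InnerProductSpace ℂ H]
  [CompleteSpace H]

lemma norm_sum_inner_le (y : CStarMatrix ι ι (H →L[ℂ] H)) (g h : PiLp 2 fun _ : ι => H) :
    ‖∑ i, ∑ j, ⟪g i, y i j (h j)⟫_ℂ‖ ≤ ‖y‖ * ‖g‖ * ‖h‖ := by
  classical
  rw [← inner_operatorMatrix, ← norm_operatorMatrix]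
  calc _ ≤ ‖g‖ * (‖operatorMatrix ι H y‖ * ‖h‖) :=
        (norm_inner_le_norm _ _).trans (by gcongr; exact ContinuousLinearMap.le_opNorm _ _)
    _ = _ := by ring

lemma norm_le_of_forall_norm_sum_inner_le {y : CStarMatrix ι ι (H →L[ℂ] H)} {C : ℝ} (hC : 0 ≤ C)
    (hy : ∀ g h : PiLp 2 fun _ : ι => H,
      ‖∑ i, ∑ j, ⟪g i, y i j (h j)⟫_ℂ‖ ≤ C * ‖g‖ * ‖h‖) : ‖y‖ ≤ C := by
  classical
  rw [← norm_operatorMatrix]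
  refine ContinuousLinearMap.opNorm_le_of_re_inner_le hC fun h g hh hg => ?_
  rw [inner_re_symm]
  refine (RCLike.re_le_norm _).trans ?_
  rw [inner_operatorMatrix]
  simpa [hg, hh] using hy g h

lemma nonneg_iff_forall_sum_inner {y : CStarMatrix ι ι (H →L[ℂ] H)} :
    0 ≤ y ↔ ∀ h : PiLp 2 fun _ : ι => H, 0 ≤ ∑ i, ∑ j, ⟪h i, y i j (h j)⟫_ℂ := by
  classical
  rw [← operatorMatrix_nonneg_iff, ContinuousLinearMap.nonneg_iff_isPositive,
    ContinuousLinearMap.isPositive_iff_complex]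
  refine forall_congr' fun h => ?_
  rw [← inner_operatorMatrix, ← star_nonneg_iff (x := ⟪h, _⟫_ℂ), ← starRingEnd_apply,
    inner_conj_symm, Complex.nonneg_iff, Complex.ext_iff]
  simp [and_comm]

end MatrixForm

lemma norm_toLp_apply_le {ι K H : Type*} [Fintype ι] [NormedAddCommGroup K]
    [InnerProductSpace ℂ K] [NormedAddCommGroup H] [InnerProductSpace ℂ H] (V : K →L[ℂ] H)
    (h : PiLp 2 fun _ : ι => K) :
    ‖(WithLp.toLp 2 fun i => V (h i) : PiLp 2 fun _ : ι => H)‖ ≤ ‖V‖ * ‖h‖ := by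
  rw [← sq_le_sq₀ (norm_nonneg _) (by positivity), mul_pow, PiLp.norm_sq_eq_of_L2,
    PiLp.norm_sq_eq_of_L2, Finset.mul_sum]
  gcongr with i
  rw [← mul_pow]
  gcongr
  exact V.le_opNorm _

section Factorization

variable {A : Type*} [CStarAlgebra A]
  {K H : Type*} [NormedAddCommGroup K] [InnerProductSpace ℂ K] [CompleteSpace K]
  [NormedAddCommGroup H] [InnerProductSpace ℂ H] [CompleteSpace H]
  {E : Submodule ℂ A} {u : E →ₗ[ℂ] (K →L[ℂ] K)} {π : A →⋆ₐ[ℂ] (H →L[ℂ] H)}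

lemma sum_inner_amplification {V W : K →L[ℂ] H}
    (hu : ∀ a : E, u a = V.adjoint ∘L π (a : A) ∘L W) {n : ℕ} (x : matrixSpace E n)
    (g h : Fin n → K) :
    ∑ i, ∑ j, ⟪g i, amplification u n x i j (h j)⟫_ℂ =
      ∑ i, ∑ j, ⟪V (g i), (x : CStarMatrix (Fin n) (Fin n) A).map π i j (W (h j))⟫_ℂ := by
  refine Finset.sum_congr rfl fun i _ => Finset.sum_congr rfl fun j _ => ?_
  change ⟪g i, u ⟨x.1 i j, x.2 i j⟩ (h j)⟫_ℂ = _
  rw [hu]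
  exact V.adjoint_inner_right _ _

variable [PartialOrder A] [StarOrderedRing A]

lemma isCompletelyPositive_of_factorization {V : K →L[ℂ] H}
    (hu : ∀ a : E, u a = V.adjoint ∘L π (a : A) ∘L V) : IsCompletelyPositive u := by
  intro n x hx
  rw [nonneg_iff_forall_sum_inner]
  intro h
  rw [sum_inner_amplification hu]
  have hπ : 0 ≤ CStarMatrix.mapₙₐ (π : A →⋆ₙₐ[ℂ] (H →L[ℂ] H)) x.1 := map_nonneg _ hx
  exact nonneg_iff_forall_sum_inner.mp hπ (WithLp.toLp 2 fun i => V (h i))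

lemma cbNorm_le_of_factorization {V W : K →L[ℂ] H}
    (hu : ∀ a : E, u a = V.adjoint ∘L π (a : A) ∘L W) :
    cbNorm u ≤ ENNReal.ofReal (‖V‖ * ‖W‖) := by
  refine iSup₂_le fun n _ => iSup₂_le fun x hx => ?_
  rw [← ofReal_norm]
  refine ENNReal.ofReal_le_ofReal ?_
  refine norm_le_of_forall_norm_sum_inner_le (by positivity) fun g h => ?_
  rw [sum_inner_amplification hu]
  let y := CStarMatrix.mapₙₐ (π : A →⋆ₙₐ[ℂ] (H →L[ℂ] H)) x.1
  have hy : ‖y‖ ≤ 1 := (NonUnitalStarAlgHom.norm_apply_le _ _).trans hx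
  calc _ ≤ ‖y‖ * ‖(WithLp.toLp 2 fun i => V (g i) : PiLp 2 fun _ : Fin n => H)‖ *
        ‖(WithLp.toLp 2 fun i => W (h i) : PiLp 2 fun _ : Fin n => H)‖ := norm_sum_inner_le y _ _
    _ ≤ 1 * (‖V‖ * ‖g‖) * (‖W‖ * ‖h‖) := by
      gcongr <;> exact norm_toLp_apply_le _ _
    _ = _ := by ring

lemma cbNorm_le_one_of_factorization {V W : K →L[ℂ] H} (hV : ‖V‖ ≤ 1) (hW : ‖W‖ ≤ 1)
    (hu : ∀ a : E, u a = V.adjoint ∘L π (a : A) ∘L W) : cbNorm u ≤ 1 :=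
  (cbNorm_le_of_factorization hu).trans
    (ENNReal.ofReal_le_one.mpr (mul_le_one₀ hV (norm_nonneg W) hW))

end Factorization

section RieszExtension

lemma exists_nonneg_extension {P X : Type*} [AddCommGroup P] [Module ℝ P] [AddCommGroup X]
    [Module ℝ X] (s : PointedCone ℝ X) (T : P →ₗ[ℝ] X) (f : P →ₗ[ℝ] ℝ)
    (hf : ∀ p, T p ∈ s → 0 ≤ f p) (hT : ∀ x, ∃ p, T p + x ∈ s) :
    ∃ g : X →ₗ[ℝ] ℝ, (∀ p, g (T p) = f p) ∧ ∀ x ∈ s, 0 ≤ g x := by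
  have hker : LinearMap.ker T ≤ LinearMap.ker f := fun p hp => by
    rw [LinearMap.mem_ker] at hp ⊢
    have hnonneg := hf p (by rw [hp]; exact s.zero_mem)
    have hnonpos := hf (-p) (by rw [map_neg, hp, neg_zero]; exact s.zero_mem)
    rw [map_neg] at hnonpos
    linarith
  let f₀ : X →ₗ.[ℝ] ℝ :=
    ⟨LinearMap.range T, (LinearMap.ker T).liftQ f hker ∘ₗ T.quotKerEquivRange.symm.toLinearMap⟩
  have hf₀ : ∀ p (hp : T p ∈ f₀.domain), f₀ ⟨T p, hp⟩ = f p := fun p hp => by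
    change (LinearMap.ker T).liftQ f hker (T.quotKerEquivRange.symm ⟨T p, hp⟩) = f p
    rw [T.quotKerEquivRange_symm_apply_image p hp, Submodule.mkQ_apply, Submodule.liftQ_apply]
  obtain ⟨g, hg, hgs⟩ := riesz_extension s f₀
    (by
      rintro ⟨_, p, rfl⟩ hx
      exact (hf p hx).trans_eq (hf₀ p ⟨p, rfl⟩).symm)
    (fun x => by
      obtain ⟨p, hp⟩ := hT x
      exact ⟨⟨T p, p, rfl⟩, hp⟩)
  exact ⟨g, fun p => (hg ⟨T p, p, rfl⟩).trans (hf₀ p _), hgs⟩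

lemma exists_re_nonneg_extension {P X : Type*} [AddCommGroup P] [Module ℂ P] [AddCommGroup X]
    [Module ℂ X] (s : PointedCone ℝ X) (T : P →ₗ[ℂ] X) (F : P →ₗ[ℂ] ℂ)
    (hF : ∀ p, T p ∈ s → 0 ≤ (F p).re) (hT : ∀ x, ∃ p, T p + x ∈ s) :
    ∃ G : X →ₗ[ℂ] ℂ, (∀ p, G (T p) = F p) ∧ ∀ x ∈ s, 0 ≤ (G x).re := by
  obtain ⟨g, hgT, hg⟩ := exists_nonneg_extension s (T.restrictScalars ℝ)
    (Complex.reLm ∘ₗ F.restrictScalars ℝ) hF hT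
  have hre : ∀ x, (Module.Dual.extendRCLike (𝕜 := ℂ) g x).re = g x :=
    Module.Dual.re_extendRCLike_apply (𝕜 := ℂ) g
  have him : ∀ x, (Module.Dual.extendRCLike (𝕜 := ℂ) g x).im = -g (Complex.I • x) :=
    Module.Dual.im_extendRCLike_apply (𝕜 := ℂ) g
  have hgT' : ∀ p, g (T p) = (F p).re := hgT
  refine ⟨Module.Dual.extendRCLike g, fun p => Complex.ext ?_ ?_,
    fun x hx => (hg x hx).trans_eq (hre x).symm⟩
  · rw [hre, hgT']
  · rw [him, ← map_smul, hgT', map_smul]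
    simp

end RieszExtension

section Accretive

variable {I : Type*} {A : Type*} [CStarAlgebra A]

/-- The finitely supported `I × I` matrix `[star (x i) * y j]`. -/
def starOuter (x y : I →₀ A) : I × I →₀ A :=
  Finsupp.onFinset (x.support ×ˢ y.support) (fun p => star (x p.1) * y p.2) fun p hp => by
    rw [Finset.mem_product, Finsupp.mem_support_iff, Finsupp.mem_support_iff]
    constructor <;> intro h <;> simp [h] at hp

@[simp]
lemma starOuter_apply (x y : I →₀ A) (p : I × I) : starOuter x y p = star (x p.1) * y p.2 := rfl

lemma starOuter_add_left (x y z : I →₀ A) :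
    starOuter (x + y) z = starOuter x z + starOuter y z := by
  ext p
  simp [add_mul]

lemma starOuter_add_right (x y z : I →₀ A) :
    starOuter x (y + z) = starOuter x y + starOuter x z := by
  ext p
  simp [mul_add]

lemma starOuter_smul_left (c : ℂ) (x y : I →₀ A) :
    starOuter (c • x) y = conj c • starOuter x y := by
  ext p
  simp

lemma starOuter_single (i j : I) (a b : A) :
    starOuter (Finsupp.single i a) (Finsupp.single j b) = Finsupp.single (i, j) (star a * b) := by
  classical
  ext ⟨k, l⟩
  simp only [starOuter_apply, Finsupp.single_apply, Prod.mk.injEq]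
  split_ifs <;> simp_all

variable [PartialOrder A] [StarOrderedRing A]

lemma star_mul_matrix_nonneg {ι : Type*} [Fintype ι] (v : ι → A) :
    0 ≤ (CStarMatrix.ofMatrix (.of fun i j => star (v i) * v j) : CStarMatrix ι ι A) := by
  classical
  rcases isEmpty_or_nonempty ι with _ | ⟨⟨k⟩⟩
  · exact le_of_eq (CStarMatrix.ext isEmptyElim)
  let R : CStarMatrix ι ι A := CStarMatrix.ofMatrix (.of fun i j => if i = k then v j else 0)
  convert star_mul_self_nonneg R using 1
  ext i j
  simp [R, CStarMatrix.mul_apply, CStarMatrix.star_apply, apply_ite]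

variable (I A) in
/-- The cone of the finitely supported matrices `x` for which `x + star x` is positive, tested on
the finite square submatrices. -/
def accretiveCone : PointedCone ℝ (I × I →₀ A) where
  carrier := {x | ∀ (n : ℕ) (e : Fin n → I),
    0 ≤ (CStarMatrix.ofMatrix (.of fun i j => x (e i, e j) + star (x (e j, e i))) :
      CStarMatrix (Fin n) (Fin n) A)}
  add_mem' {x y} hx hy n e := by
    convert add_nonneg (hx n e) (hy n e) using 1
    ext i j
    simp [add_add_add_comm]
  zero_mem' n e := by
    refine le_of_eq ?_
    ext i j
    simp
  smul_mem' c x hx n e := by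
    convert smul_nonneg c.2 (hx n e) using 1
    ext i j
    obtain ⟨c, hc⟩ := c
    simp

lemma starOuter_self_mem_accretiveCone (v : I →₀ A) : starOuter v v ∈ accretiveCone I A :=
  fun n e => by
    have h := star_mul_matrix_nonneg fun i => v (e i)
    convert add_nonneg h h using 1
    ext i j
    simp

lemma mem_accretiveCone_of_add_star_eq_zero {x : I × I →₀ A}
    (hx : ∀ i j, x (i, j) + star (x (j, i)) = 0) : x ∈ accretiveCone I A :=
  fun _ _ => le_of_eq (CStarMatrix.ext fun _ _ => (hx _ _).symm)

lemma exists_star_mul_self_add (a : A) :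
    ∃ d : A, star a * a + star d * d = ((‖a‖ ^ 2 : ℝ) : ℂ) • 1 := by
  obtain ⟨d, hd⟩ := CStarAlgebra.nonneg_iff_eq_star_mul_self.mp
    (sub_nonneg.mpr (CStarAlgebra.star_mul_le_algebraMap_norm_sq (a := a)))
  refine ⟨d, ?_⟩
  rw [← hd, add_sub_cancel, Complex.coe_smul, Algebra.algebraMap_eq_smul_one]

/- With `v = e_i + a e_j` and `star a * a + star d * d = ‖a‖²`, the sum of `v* v` and
`(d e_j)* (d e_j)` is twice the claimed matrix up to a skew-adjoint one. -/
lemma exists_add_single_mem_accretiveCone (i j : I) (a : A) : ∃ c d : ℂ,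
    c • Finsupp.single (i, i) 1 + d • Finsupp.single (j, j) 1 + Finsupp.single (i, j) a ∈
      accretiveCone I A := by
  classical
  obtain ⟨d, hd⟩ := exists_star_mul_self_add a
  refine ⟨2⁻¹, 2⁻¹ * (‖a‖ ^ 2 : ℝ), ?_⟩
  have hgram := add_mem
    (starOuter_self_mem_accretiveCone (Finsupp.single i 1 + Finsupp.single j a))
    (starOuter_self_mem_accretiveCone (Finsupp.single j d))
  have hskew : (2⁻¹ : ℝ) • (Finsupp.single (i, j) a - Finsupp.single (j, i) (star a)) ∈
      accretiveCone I A := by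
    refine mem_accretiveCone_of_add_star_eq_zero fun k l => ?_
    have hstar : star (Finsupp.single (i, j) a (l, k)) = Finsupp.single (j, i) (star a) (k, l) ∧
        star (Finsupp.single (j, i) (star a) (l, k)) = Finsupp.single (i, j) a (k, l) := by
      simp [Finsupp.single_apply, apply_ite star, and_comm]
    simp [star_smul, hstar.1, hstar.2, ← smul_add]
  have hdiag : ((‖a‖ ^ 2 : ℝ) : ℂ) • Finsupp.single (j, j) (1 : A) =
      Finsupp.single (j, j) (star a * a) + Finsupp.single (j, j) (star d * d) := by
    rw [← Finsupp.single_add, hd, Finsupp.smul_single]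
  convert add_mem hskew ((accretiveCone I A).smul_mem (by norm_num : (0 : ℝ) ≤ 2⁻¹) hgram) using 1
  rw [starOuter_add_left, starOuter_add_right, starOuter_add_right, mul_smul, hdiag,
    ← Complex.coe_smul, ← Complex.coe_smul]
  simp only [starOuter_single, star_one, one_mul, mul_one]
  push_cast
  module

end Accretive

/-- A functional on the finitely supported `I × I` matrices over `A` which is hermitian and
positive on the matrices `[star (x i) * x j]`: the datum of a GNS construction on the
finitely supported functions `I →₀ A`. -/
structure PositiveForm (I A : Type*) [CStarAlgebra A] where
  toFun : (I × I →₀ A) →ₗ[ℂ] ℂ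
  conj_starOuter : ∀ x y : I →₀ A, conj (toFun (starOuter x y)) = toFun (starOuter y x)
  re_nonneg : ∀ x : I →₀ A, 0 ≤ (toFun (starOuter x x)).re

namespace PositiveForm

section GNS

variable {I : Type*} {A : Type*} [CStarAlgebra A] (φ : PositiveForm I A)

/-- A copy of `I →₀ A`, which carries the semi-inner product `⟪x, y⟫ = φ [star (x i) * y j]`. -/
def PreGNS (_φ : PositiveForm I A) := I →₀ A

instance : AddCommGroup φ.PreGNS := inferInstanceAs (AddCommGroup (I →₀ A))
instance : Module ℂ φ.PreGNS := inferInstanceAs (Module ℂ (I →₀ A))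

/-- The identity map, as a linear equivalence onto the type synonym. -/
def toPreGNS : (I →₀ A) ≃ₗ[ℂ] φ.PreGNS := LinearEquiv.refl ℂ _

/-- The semi-inner product given by a positive form. -/
abbrev preInnerProductCore : PreInnerProductSpace.Core ℂ φ.PreGNS where
  inner x y := φ.toFun (starOuter (φ.toPreGNS.symm x) (φ.toPreGNS.symm y))
  conj_inner_symm x y := φ.conj_starOuter _ _
  re_inner_nonneg x := φ.re_nonneg _
  add_left x y z := by rw [map_add, starOuter_add_left, map_add]
  smul_left x y c := by rw [map_smul, starOuter_smul_left, map_smul, smul_eq_mul]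

instance : SeminormedAddCommGroup φ.PreGNS :=
  InnerProductSpace.Core.toSeminormedAddCommGroup (c := φ.preInnerProductCore)
instance : InnerProductSpace ℂ φ.PreGNS :=
  InnerProductSpace.ofCore φ.preInnerProductCore

lemma inner_toPreGNS (x y : I →₀ A) :
    ⟪φ.toPreGNS x, φ.toPreGNS y⟫_ℂ = φ.toFun (starOuter x y) := rfl

lemma norm_sq_toPreGNS (x : I →₀ A) :
    ‖φ.toPreGNS x‖ ^ 2 = (φ.toFun (starOuter x x)).re := by
  rw [← inner_toPreGNS, ← inner_self_eq_norm_sq (𝕜 := ℂ), RCLike.re_to_complex]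

/-- The Hilbert space of a positive form. -/
abbrev GNS := UniformSpace.Completion φ.PreGNS

variable {φ} in
lemma gns_ext {S T : φ.GNS →L[ℂ] φ.GNS}
    (h : ∀ x, S (φ.toPreGNS x : φ.PreGNS) = T (φ.toPreGNS x : φ.PreGNS)) : S = T := by
  ext y
  induction y using UniformSpace.Completion.induction_on with
  | hp => apply isClosed_eq <;> fun_prop
  | ih y => exact h (φ.toPreGNS.symm y)

/-- Entrywise left multiplication by `a` on `I →₀ A`. -/
def finsuppMulLeft (I : Type*) (a : A) : (I →₀ A) →ₗ[ℂ] (I →₀ A) :=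
  Finsupp.mapRange.linearMap (LinearMap.mulLeft ℂ a)

@[simp]
lemma finsuppMulLeft_apply (a : A) (x : I →₀ A) (i : I) : finsuppMulLeft I a x i = a * x i := rfl

lemma starOuter_finsuppMulLeft (a : A) (x y : I →₀ A) :
    starOuter (finsuppMulLeft I a x) y = starOuter x (finsuppMulLeft I (star a) y) := by
  ext p
  simp [mul_assoc]

variable [PartialOrder A] [StarOrderedRing A]

lemma re_starOuter_finsuppMulLeft_le (a : A) (x : I →₀ A) :
    (φ.toFun (starOuter (finsuppMulLeft I a x) (finsuppMulLeft I a x))).re ≤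
      ‖a‖ ^ 2 * (φ.toFun (starOuter x x)).re := by
  obtain ⟨d, hd⟩ := exists_star_mul_self_add a
  have hsum : starOuter (finsuppMulLeft I a x) (finsuppMulLeft I a x) +
      starOuter (finsuppMulLeft I d x) (finsuppMulLeft I d x) =
        ((‖a‖ ^ 2 : ℝ) : ℂ) • starOuter x x := by
    ext p
    simpa [mul_assoc, mul_add, add_mul] using congrArg (fun t => star (x p.1) * t * x p.2) hd
  have hre := congrArg (fun t => (φ.toFun t).re) hsum
  simp only [map_add, map_smul, Complex.add_re, smul_eq_mul, Complex.re_ofReal_mul] at hre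
  linarith [φ.re_nonneg (finsuppMulLeft I d x)]

/-- Left multiplication by `a` on the pre-Hilbert space of a positive form. -/
def mulLeft (a : A) : φ.PreGNS →L[ℂ] φ.PreGNS :=
  LinearMap.mkContinuous
    (φ.toPreGNS.toLinearMap ∘ₗ finsuppMulLeft I a ∘ₗ φ.toPreGNS.symm.toLinearMap) ‖a‖ fun x => by
      obtain ⟨x, rfl⟩ := φ.toPreGNS.surjective x
      rw [← sq_le_sq₀ (norm_nonneg _) (by positivity), mul_pow, norm_sq_toPreGNS]
      exact (φ.norm_sq_toPreGNS _).trans_le (φ.re_starOuter_finsuppMulLeft_le a x)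

lemma completion_mulLeft_coe (a : A) (x : I →₀ A) :
    (φ.mulLeft a).completion (φ.toPreGNS x : φ.PreGNS) =
      (φ.toPreGNS (finsuppMulLeft I a x) : φ.PreGNS) :=
  ContinuousLinearMap.completion_apply_coe _ _

/-- The representation of `A` on the Hilbert space of a positive form. -/
def gnsRep : A →⋆ₐ[ℂ] (φ.GNS →L[ℂ] φ.GNS) where
  toFun a := (φ.mulLeft a).completion
  map_one' := gns_ext fun x => by
    have : finsuppMulLeft I (1 : A) x = x := by ext; simp
    rw [completion_mulLeft_coe, this, one_apply_eq_self]
  map_mul' a b := gns_ext fun x => by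
    have : finsuppMulLeft I (a * b) x = finsuppMulLeft I a (finsuppMulLeft I b x) := by
      ext; simp [mul_assoc]
    rw [mul_apply_eq_comp, completion_mulLeft_coe, completion_mulLeft_coe,
      completion_mulLeft_coe, this]
  map_zero' := gns_ext fun x => by
    have : finsuppMulLeft I (0 : A) x = 0 := by ext; simp
    rw [completion_mulLeft_coe, this, map_zero, UniformSpace.Completion.coe_zero, zero_apply]
  map_add' a b := gns_ext fun x => by
    have : finsuppMulLeft I (a + b) x = finsuppMulLeft I a x + finsuppMulLeft I b x := by
      ext; simp [add_mul]
    rw [add_apply, completion_mulLeft_coe, completion_mulLeft_coe, completion_mulLeft_coe, this,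
      map_add, UniformSpace.Completion.coe_add]
  commutes' c := gns_ext fun x => by
    have : finsuppMulLeft I (algebraMap ℂ A c) x = c • x := by
      ext; simp [Algebra.algebraMap_eq_smul_one]
    rw [completion_mulLeft_coe, this, map_smul, UniformSpace.Completion.coe_smul,
      Algebra.algebraMap_eq_smul_one, smul_apply, one_apply_eq_self]
  map_star' a := by
    refine (ContinuousLinearMap.eq_adjoint_iff _ _).mpr fun x y => ?_
    induction x, y using UniformSpace.Completion.induction_on₂ with
    | hp => apply isClosed_eq <;> fun_prop
    | ih x y =>
      obtain ⟨x, rfl⟩ := φ.toPreGNS.surjective x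
      obtain ⟨y, rfl⟩ := φ.toPreGNS.surjective y
      rw [completion_mulLeft_coe, completion_mulLeft_coe, UniformSpace.Completion.inner_coe,
        UniformSpace.Completion.inner_coe, inner_toPreGNS, inner_toPreGNS,
        starOuter_finsuppMulLeft, star_star]

/-- The class of the function supported at `i` with value `1`. -/
def gnsVector (i : I) : φ.GNS := (φ.toPreGNS (Finsupp.single i 1) : φ.PreGNS)

lemma inner_gnsRep_gnsVector (i j : I) (a : A) :
    ⟪φ.gnsVector i, φ.gnsRep a (φ.gnsVector j)⟫_ℂ = φ.toFun (Finsupp.single (i, j) a) := by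
  have hrep : φ.gnsRep a (φ.gnsVector j) = (φ.toPreGNS (Finsupp.single j a) : φ.PreGNS) := by
    refine (φ.completion_mulLeft_coe a _).trans ?_
    rw [finsuppMulLeft, Finsupp.mapRange.linearMap_apply, Finsupp.mapRange_single,
      LinearMap.mulLeft_apply, mul_one]
  rw [hrep, gnsVector, UniformSpace.Completion.inner_coe, inner_toPreGNS, starOuter_single,
    star_one, one_mul]

end GNS

variable {I : Type*} {A : Type*} [CStarAlgebra A] [PartialOrder A] [StarOrderedRing A]

/-- A functional with nonnegative real part on the accretive cone, as a positive form. -/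
def ofAccretive (G : (I × I →₀ A) →ₗ[ℂ] ℂ) (hG : ∀ x ∈ accretiveCone I A, 0 ≤ (G x).re) :
    PositiveForm I A where
  toFun := G
  conj_starOuter x y := by
    have hskew : ∀ z : I × I →₀ A, (∀ i j, z (i, j) + star (z (j, i)) = 0) → (G z).re = 0 :=
      fun z hz => by
        have hneg := hG (-z) (mem_accretiveCone_of_add_star_eq_zero fun i j => by
          rw [Finsupp.neg_apply, Finsupp.neg_apply, star_neg, ← neg_add, hz, neg_zero])
        rw [map_neg, Complex.neg_re] at hneg
        linarith [hG z (mem_accretiveCone_of_add_star_eq_zero hz)]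
    have hre := hskew (starOuter x y - starOuter y x) fun i j => by simp
    have him := hskew (Complex.I • (starOuter x y + starOuter y x)) fun i j => by simp
    simp only [map_sub, map_smul, map_add, smul_eq_mul, Complex.sub_re, Complex.mul_re,
      Complex.I_re, Complex.I_im, Complex.add_re, Complex.add_im] at hre him
    refine Complex.ext ?_ ?_
    · rw [Complex.conj_re]
      linarith
    · rw [Complex.conj_im]
      linarith
  re_nonneg x := hG _ (starOuter_self_mem_accretiveCone x)

end PositiveForm

/-- Arveson's extension theorem and Stinespring's dilation theorem in one: the functional `F`,
positive on a space of matrices containing the diagonal units, extends to all matrices, and the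
GNS representation of the extension dilates it. -/
theorem exists_representation_of_re_nonneg {I : Type uK} {A : Type uA} [CStarAlgebra A]
    [PartialOrder A] [StarOrderedRing A] {P : Type*} [AddCommGroup P] [Module ℂ P]
    (T : P →ₗ[ℂ] (I × I →₀ A)) (F : P →ₗ[ℂ] ℂ)
    (hF : ∀ p, T p ∈ accretiveCone I A → 0 ≤ (F p).re)
    (hone : ∀ i, ∃ p, T p = Finsupp.single (i, i) 1) :
    ∃ (H : Type (max uK uA)) (_ : NormedAddCommGroup H) (_ : InnerProductSpace ℂ H)
      (_ : CompleteSpace H) (π : A →⋆ₐ[ℂ] (H →L[ℂ] H)) (ξ : I → H),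
      ∀ p i j a, T p = Finsupp.single (i, j) a → ⟪ξ i, π a (ξ j)⟫_ℂ = F p := by
  have hdominated : ∀ x, ∃ p, T p + x ∈ accretiveCone I A := fun x => by
    induction x using Finsupp.induction_linear with
    | zero => exact ⟨0, by simp⟩
    | add x y hx hy =>
      obtain ⟨p, hp⟩ := hx
      obtain ⟨q, hq⟩ := hy
      exact ⟨p + q, by rw [map_add, add_add_add_comm]; exact add_mem hp hq⟩
    | single q a =>
      obtain ⟨p₁, h₁⟩ := hone q.1
      obtain ⟨p₂, h₂⟩ := hone q.2
      obtain ⟨c, d, hcd⟩ := exists_add_single_mem_accretiveCone q.1 q.2 a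
      exact ⟨c • p₁ + d • p₂, by rwa [map_add, map_smul, map_smul, h₁, h₂]⟩
  obtain ⟨G, hGT, hG⟩ := exists_re_nonneg_extension (accretiveCone I A) T F hF hdominated
  let φ := PositiveForm.ofAccretive G hG
  refine ⟨φ.GNS, inferInstance, inferInstance, inferInstance, φ.gnsRep, φ.gnsVector,
    fun p i j a hp => ?_⟩
  rw [φ.inner_gnsRep_gnsVector, ← hp]
  exact hGT p

section Dilation

lemma finsupp_sum_prod_eq_sum_fin {I M N : Type*} [Zero M] [AddCommMonoid N] (p : I × I →₀ M)
    (β : I × I → M → N) (hβ : ∀ q, β q 0 = 0) :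
    ∃ (n : ℕ) (e : Fin n → I), p.sum β = ∑ i, ∑ j, β (e i, e j) (p (e i, e j)) := by
  classical
  let s := p.support.image Prod.fst ∪ p.support.image Prod.snd
  have hs : p.support ⊆ s ×ˢ s := fun q hq => Finset.mem_product.mpr
    ⟨Finset.mem_union_left _ (Finset.mem_image_of_mem _ hq),
      Finset.mem_union_right _ (Finset.mem_image_of_mem _ hq)⟩
  have hsum : ∀ f : I → N, ∑ k ∈ s, f k = ∑ i, f (s.equivFin.symm i) := fun f => by
    rw [s.equivFin.symm.sum_comp fun k => f k, Finset.sum_coe_sort s f]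
  refine ⟨s.card, fun i => s.equivFin.symm i, ?_⟩
  rw [Finsupp.sum_of_support_subset p hs β fun q _ => hβ q, Finset.sum_product, hsum]
  exact Finset.sum_congr rfl fun i _ => hsum _

variable {K : Type uK} [NormedAddCommGroup K] [InnerProductSpace ℂ K]

lemma exists_clm_of_inner_eq {H : Type*} [NormedAddCommGroup H] [InnerProductSpace ℂ H]
    {ξ : K → H} {R : K →L[ℂ] K} (hξ : ∀ k l, ⟪ξ k, ξ l⟫_ℂ = ⟪k, R l⟫_ℂ) :
    ∃ V : K →L[ℂ] H, ‖V‖ ≤ √‖R‖ ∧ ∀ k, V k = ξ k := by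
  have hadd : ∀ k l, ξ (k + l) = ξ k + ξ l := fun k l => by
    rw [← sub_eq_zero, ← inner_self_eq_zero (𝕜 := ℂ)]
    simp only [inner_sub_left, inner_sub_right, inner_add_left, inner_add_right, hξ, map_add]
    ring
  have hsmul : ∀ (c : ℂ) k, ξ (c • k) = c • ξ k := fun c k => by
    rw [← sub_eq_zero, ← inner_self_eq_zero (𝕜 := ℂ)]
    simp only [inner_sub_left, inner_sub_right, inner_smul_left, inner_smul_right, hξ, map_smul]
    ring
  have hbound : ∀ k, ‖ξ k‖ ≤ √‖R‖ * ‖k‖ := fun k => by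
    rw [← sq_le_sq₀ (norm_nonneg _) (by positivity), mul_pow, Real.sq_sqrt (norm_nonneg _),
      ← inner_self_eq_norm_sq (𝕜 := ℂ), hξ]
    calc RCLike.re ⟪k, R k⟫_ℂ ≤ ‖k‖ * ‖R k‖ := re_inner_le_norm _ _
      _ ≤ ‖k‖ * (‖R‖ * ‖k‖) := by gcongr; exact R.le_opNorm k
      _ = ‖R‖ * ‖k‖ ^ 2 := by ring
  exact ⟨LinearMap.mkContinuous ⟨⟨ξ, hadd⟩, hsmul⟩ _ hbound,
    LinearMap.mkContinuous_norm_le _ (by positivity) _, fun _ => rfl⟩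

variable {A : Type uA} [CStarAlgebra A] [PartialOrder A] [StarOrderedRing A]
  {Q : Type*} [AddCommGroup Q] [Module ℂ Q]

/-- Whenever a matrix `[T (q i j)]` has positive real part, so has `[Φ (q i j)]`. For `T` the
inclusion of an operator system, this says that `Φ` is completely positive; allowing an arbitrary
parametrisation `T` avoids assumptions on the range of `T`. -/
def IsCompletelyAccretive (T : Q →ₗ[ℂ] A) (Φ : Q →ₗ[ℂ] (K →L[ℂ] K)) : Prop :=
  ∀ (n : ℕ) (q : Fin n → Fin n → Q),
    0 ≤ (CStarMatrix.ofMatrix (.of fun i j => T (q i j) + star (T (q j i))) :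
      CStarMatrix (Fin n) (Fin n) A) →
    ∀ h : Fin n → K, 0 ≤ (∑ i, ∑ j, ⟪h i, Φ (q i j) (h j)⟫_ℂ).re

variable [CompleteSpace K]

theorem IsCompletelyAccretive.exists_dilation {T : Q →ₗ[ℂ] A} {Φ : Q →ₗ[ℂ] (K →L[ℂ] K)}
    (h : IsCompletelyAccretive T Φ) {q₁ : Q} (hq₁ : T q₁ = 1) :
    ∃ (H : Type (max uA uK w)) (_ : NormedAddCommGroup H) (_ : InnerProductSpace ℂ H)
      (_ : CompleteSpace H) (π : A →⋆ₐ[ℂ] (H →L[ℂ] H)) (V : K →L[ℂ] H),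
      ‖V‖ ≤ √‖Φ q₁‖ ∧ ∀ q, Φ q = V.adjoint ∘L π (T q) ∘L V := by
  let I : Type (max uK w) := ULift.{w} K
  let coeff (p : I × I) : Q →ₗ[ℂ] ℂ :=
    innerₛₗ ℂ p.1.down ∘ₗ (ContinuousLinearMap.apply ℂ K p.2.down).toLinearMap ∘ₗ Φ
  let F : (I × I →₀ Q) →ₗ[ℂ] ℂ := Finsupp.lsum ℂ coeff
  have hF : ∀ p, Finsupp.mapRange.linearMap T p ∈ accretiveCone I A → 0 ≤ (F p).re :=
    fun p hp => by
      obtain ⟨n, e, he⟩ := finsupp_sum_prod_eq_sum_fin p (fun k => coeff k) fun k => map_zero _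
      exact (h n (fun i j => p (e i, e j)) (hp n e) fun i => (e i).down).trans_eq
        (congrArg Complex.re he.symm)
  obtain ⟨H, _, _, _, π, ξ, hξ⟩ := exists_representation_of_re_nonneg _ F hF
    fun i => ⟨Finsupp.single (i, i) q₁, by simp [hq₁]⟩
  have hcoeff : ∀ k l q, ⟪ξ ⟨k⟩, π (T q) (ξ ⟨l⟩)⟫_ℂ = ⟪k, Φ q l⟫_ℂ := fun k l q => by
    rw [hξ (Finsupp.single (⟨k⟩, ⟨l⟩) q) _ _ _ (by simp)]
    simp [F, coeff]
  obtain ⟨V, hV, hVξ⟩ := exists_clm_of_inner_eq (ξ := fun k => ξ ⟨k⟩) (R := Φ q₁) fun k l => by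
    rw [← hcoeff, hq₁, map_one, one_apply_eq_self]
  refine ⟨H, inferInstance, inferInstance, inferInstance, π, V, hV, fun q => ?_⟩
  ext l
  refine ext_inner_left ℂ fun k => ?_
  rw [← hcoeff, ContinuousLinearMap.comp_apply, ContinuousLinearMap.adjoint_inner_right,
    ContinuousLinearMap.comp_apply, hVξ, hVξ]

end Dilation

section CompletelyPositive

variable {A : Type uA} [CStarAlgebra A] [PartialOrder A] [StarOrderedRing A]
  {K : Type uK} [NormedAddCommGroup K] [InnerProductSpace ℂ K] [CompleteSpace K]
  {E : Submodule ℂ A} {u : E →ₗ[ℂ] (K →L[ℂ] K)}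

/- With `star a * a + star d * d = ‖a‖²`, the matrix `[[1, a], [star a, ‖a‖²]]` is a Gram matrix,
hence positive, and so is its image under `u`; positive matrices are hermitian. -/
lemma IsCompletelyPositive.map_star (hu : IsCompletelyPositive u) (hone : 1 ∈ E)
    (hstar : ∀ x ∈ E, star x ∈ E) (a : E) : u ⟨star a, hstar a a.2⟩ = star (u a) := by
  obtain ⟨d, hd⟩ := exists_star_mul_self_add (a : A)
  let x : CStarMatrix (Fin 2) (Fin 2) A := CStarMatrix.ofMatrix
    !![1, (a : A); star (a : A), star (a : A) * a + star d * d]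
  have hx : 0 ≤ x := by
    convert add_nonneg (star_mul_matrix_nonneg ![1, (a : A)]) (star_mul_matrix_nonneg ![0, d])
      using 1
    ext i j
    fin_cases i <;> fin_cases j <;> simp [x]
  have hdE : star (a : A) * a + star d * d ∈ E := hd ▸ E.smul_mem _ hone
  have hxE : x ∈ matrixSpace E 2 := fun i j => by
    fin_cases i <;> fin_cases j
    exacts [hone, a.2, hstar a a.2, hdE]
  exact (CStarMatrix.star_apply_of_isSelfAdjoint
    (IsSelfAdjoint.of_nonneg (hu 2 ⟨x, hxE⟩ hx)) (i := 0) (j := 1)).symm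

lemma re_sum_sum_inner_add_star {ι : Type*} [Fintype ι] (y : ι → ι → (K →L[ℂ] K)) (h : ι → K) :
    (∑ i, ∑ j, ⟪h i, (y i j + star (y j i)) (h j)⟫_ℂ).re =
      2 * (∑ i, ∑ j, ⟪h i, y i j (h j)⟫_ℂ).re := by
  have hstar : ∑ i, ∑ j, ⟪h i, star (y j i) (h j)⟫_ℂ = conj (∑ i, ∑ j, ⟪h i, y i j (h j)⟫_ℂ) := by
    simp only [map_sum, inner_conj_symm, ContinuousLinearMap.star_eq_adjoint,
      ContinuousLinearMap.adjoint_inner_right]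
    exact Finset.sum_comm
  simp only [add_apply, inner_add_right, Finset.sum_add_distrib, hstar, Complex.add_re,
    Complex.conj_re]
  ring

lemma IsCompletelyPositive.isCompletelyAccretive (hu : IsCompletelyPositive u) (hone : 1 ∈ E)
    (hstar : ∀ x ∈ E, star x ∈ E) : IsCompletelyAccretive E.subtype u := by
  intro n q hq h
  let x : matrixSpace E n :=
    ⟨_, fun i j => E.add_mem (q i j).2 (hstar _ (q j i).2)⟩
  have hux : ∀ i j, amplification u n x i j = u (q i j) + star (u (q j i)) := fun i j => by
    rw [← hu.map_star hone hstar, ← map_add]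
    rfl
  have hpos := nonneg_iff_forall_sum_inner.mp (hu n x hq) (WithLp.toLp 2 h)
  simp only [hux] at hpos
  have hre := re_sum_sum_inner_add_star (fun i j => u (q i j)) h
  linarith [(Complex.nonneg_iff.mp hpos).1]

theorem IsCompletelyPositive.exists_dilation (hu : IsCompletelyPositive u) (hone : 1 ∈ E)
    (hstar : ∀ x ∈ E, star x ∈ E) :
    ∃ (H : Type (max uA uK w)) (_ : NormedAddCommGroup H) (_ : InnerProductSpace ℂ H)
      (_ : CompleteSpace H) (π : A →⋆ₐ[ℂ] (H →L[ℂ] H)) (V : K →L[ℂ] H),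
      ‖V‖ ≤ √‖u ⟨1, hone⟩‖ ∧ ∀ a : E, u a = V.adjoint ∘L π (a : A) ∘L V :=
  (hu.isCompletelyAccretive hone hstar).exists_dilation rfl

end CompletelyPositive

section ScalarMatrix

variable {ι : Type*} [Fintype ι] [DecidableEq ι] {A : Type*} [CStarAlgebra A]

variable (ι A) in
/-- The inclusion `M_ι(ℂ) ⊆ M_ι(A)` of the matrices with scalar entries. -/
def scalarMatrix : CStarMatrix ι ι ℂ →⋆ₐ[ℂ] CStarMatrix ι ι A :=
  { CStarMatrix.mapₙₐ (StarAlgHom.ofId ℂ A : ℂ →⋆ₙₐ[ℂ] A) with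
    map_one' := by
      ext i j
      by_cases h : i = j <;> simp [CStarMatrix.one_apply, h]
    commutes' c := by
      ext i j
      by_cases h : i = j <;> simp [CStarMatrix.algebraMap_apply, h] }

lemma scalarMatrix_apply (s : CStarMatrix ι ι ℂ) (i j : ι) :
    scalarMatrix ι A s i j = algebraMap ℂ A (s i j) := rfl

lemma scalarMatrix_injective [Nontrivial A] : Function.Injective (scalarMatrix ι A) :=
  fun _ _ hst => CStarMatrix.ext fun i j =>
    (algebraMap ℂ A).injective (congrFun₂ hst i j)

lemma mul_scalarMatrix_apply (x : CStarMatrix ι ι A) (s : CStarMatrix ι ι ℂ) (i j : ι) :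
    (x * scalarMatrix ι A s) i j = ∑ k, s k j • x i k := by
  simp only [CStarMatrix.mul_apply, scalarMatrix_apply, ← Algebra.commutes, Algebra.smul_def]

lemma scalarMatrix_mul_apply (x : CStarMatrix ι ι A) (s : CStarMatrix ι ι ℂ) (i j : ι) :
    (scalarMatrix ι A s * x) i j = ∑ k, s i k • x k j := by
  simp only [CStarMatrix.mul_apply, scalarMatrix_apply, Algebra.smul_def]

variable {B : Type*} [CStarAlgebra B] {E : Submodule ℂ A} {n : ℕ}

lemma mul_scalarMatrix_mem {x : CStarMatrix (Fin n) (Fin n) A} (hx : x ∈ matrixSpace E n)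
    (s : CStarMatrix (Fin n) (Fin n) ℂ) : x * scalarMatrix _ A s ∈ matrixSpace E n :=
  fun i j => by
    rw [mul_scalarMatrix_apply]
    exact E.sum_mem fun k _ => E.smul_mem _ (hx i k)

lemma scalarMatrix_mul_mem {x : CStarMatrix (Fin n) (Fin n) A} (hx : x ∈ matrixSpace E n)
    (s : CStarMatrix (Fin n) (Fin n) ℂ) : scalarMatrix _ A s * x ∈ matrixSpace E n :=
  fun i j => by
    rw [scalarMatrix_mul_apply]
    exact E.sum_mem fun k _ => E.smul_mem _ (hx k j)

lemma amplification_mul_scalarMatrix (u : E →ₗ[ℂ] B) (x : matrixSpace E n)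
    (s : CStarMatrix (Fin n) (Fin n) ℂ) :
    amplification u n ⟨_, mul_scalarMatrix_mem x.2 s⟩ =
      amplification u n x * scalarMatrix _ B s := by
  ext i j
  rw [mul_scalarMatrix_apply]
  calc _ = u (∑ k, s k j • ⟨x.1 i k, x.2 i k⟩) :=
        congrArg u (Subtype.ext ((mul_scalarMatrix_apply _ _ _ _).trans (by simp)))
    _ = _ := by
        rw [map_sum]
        exact Finset.sum_congr rfl fun k _ => map_smul u _ _

lemma amplification_scalarMatrix_mul (u : E →ₗ[ℂ] B) (x : matrixSpace E n)
    (s : CStarMatrix (Fin n) (Fin n) ℂ) :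
    amplification u n ⟨_, scalarMatrix_mul_mem x.2 s⟩ =
      scalarMatrix _ B s * amplification u n x := by
  ext i j
  rw [scalarMatrix_mul_apply]
  calc _ = u (∑ k, s i k • ⟨x.1 k j, x.2 k j⟩) :=
        congrArg u (Subtype.ext ((scalarMatrix_mul_apply _ _ _ _).trans (by simp)))
    _ = _ := by
        rw [map_sum]
        exact Finset.sum_congr rfl fun k _ => map_smul u _ _

end ScalarMatrix

lemma norm_sum_star_mul_le_one {C : Type*} [CStarAlgebra C] [PartialOrder C] [StarOrderedRing C]
    {κ : Type*} [Fintype κ] {P Q : κ → C} (hP : ∑ k, star (P k) * P k ≤ 1)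
    (hQ : ∑ k, star (Q k) * Q k ≤ 1) : ‖∑ k, star (P k) * Q k‖ ≤ 1 := by
  let toModule (R : κ → C) : WithCStarModule C (κ → C) :=
    (WithCStarModule.equiv C (κ → C)).symm (star R)
  have hinner : ∀ R S : κ → C, inner C (toModule S) (toModule R) = ∑ k, star (R k) * S k :=
    fun R S => by simp [WithCStarModule.pi_inner, toModule, WithCStarModule.inner_def]
  have hnorm : ∀ R : κ → C, ∑ k, star (R k) * R k ≤ 1 → ‖toModule R‖ ≤ 1 := fun R hR => by
    rw [CStarModule.norm_eq_sqrt_norm_inner_self (A := C), hinner, Real.sqrt_le_one]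
    exact (CStarAlgebra.norm_le_one_iff_of_nonneg _
      (Finset.sum_nonneg fun k _ => star_mul_self_nonneg _)).mpr hR
  rw [← hinner]
  exact (CStarModule.norm_inner_le (WithCStarModule C (κ → C))).trans
    (mul_le_one₀ (hnorm Q hQ) (norm_nonneg _) (hnorm P hP))

section CompletelyContractive

variable {A B : Type*} [CStarAlgebra A] [PartialOrder A] [StarOrderedRing A]
  [CStarAlgebra B] [PartialOrder B] [StarOrderedRing B]
  {E : Submodule ℂ A} {u : E →ₗ[ℂ] B}

lemma norm_amplification_le_one (hu : cbNorm u ≤ 1) {n : ℕ} {x : matrixSpace E n}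
    (hx : ‖x‖ ≤ 1) : ‖amplification u n x‖ ≤ 1 := by
  rcases n.eq_zero_or_pos with rfl | hn
  · rw [CStarMatrix.ext (M₁ := amplification u 0 x) (M₂ := 0) fun i => i.elim0, norm_zero]
    exact zero_le_one
  · have h : ‖amplification u n x‖ₑ ≤ 1 :=
      (le_iSup₂ (f := fun (x : matrixSpace E n) (_ : ‖x‖ ≤ 1) => ‖amplification u n x‖ₑ) x hx).trans
        ((le_iSup₂ (f := fun (n : ℕ) (_ : 1 ≤ n) => amplificationNorm u n) n hn).trans hu)
    rwa [← ofReal_norm, ENNReal.ofReal_le_one] at h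

lemma norm_apply_one_le_one (hu : cbNorm u ≤ 1) (hone : 1 ∈ E) : ‖u ⟨1, hone⟩‖ ≤ 1 := by
  have hmem : (1 : CStarMatrix (Fin 1) (Fin 1) A) ∈ matrixSpace E 1 := fun i j => by
    rwa [Subsingleton.elim i j, CStarMatrix.one_apply_eq]
  have hnorm : ‖(⟨1, hmem⟩ : matrixSpace E 1)‖ ≤ 1 :=
    (CStarAlgebra.norm_le_one_iff_of_nonneg (1 : CStarMatrix (Fin 1) (Fin 1) A)).mpr le_rfl
  exact (CStarMatrix.norm_entry_le_norm (i := (0 : Fin 1)) (j := (0 : Fin 1))).trans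
    (norm_amplification_le_one hu hnorm)

end CompletelyContractive

section ScalarGram

lemma exists_unit_star_mul_self_eq_add {C D κ : Type*} [Fintype κ] [CStarAlgebra C]
    [PartialOrder C] [StarOrderedRing C] [CStarAlgebra D] [PartialOrder D] [StarOrderedRing D]
    {φ : D →⋆ₐ[ℂ] C} (hφ : Function.Injective φ) {P : κ → C} {L : D}
    (hP : ∑ k, star (P k) * P k = φ L) {ε : ℝ} (hε : 0 < ε) :
    ∃ b : Dˣ, star (b : D) * b = L + algebraMap ℝ D ε ∧
      ∑ k, star (P k * φ ↑b⁻¹) * (P k * φ ↑b⁻¹) ≤ 1 := by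
  have hL : 0 ≤ L := (map_nonneg_iff_of_injective hφ).mp
    (hP ▸ Finset.sum_nonneg fun k _ => star_mul_self_nonneg _)
  have hLε : IsStrictlyPositive (L + algebraMap ℝ D ε) :=
    .nonneg_add hL (isStrictlyPositive_algebraMap hε)
  obtain ⟨_, ⟨b, rfl⟩, hb⟩ := CStarAlgebra.isStrictlyPositive_iff_eq_star_mul_self.mp hLε
  refine ⟨b, hb.symm, ?_⟩
  calc ∑ k, star (P k * φ ↑b⁻¹) * (P k * φ ↑b⁻¹)
      = star (φ ↑b⁻¹) * φ L * φ ↑b⁻¹ := by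
        simp only [← hP, Finset.mul_sum, Finset.sum_mul, star_mul, mul_assoc]
    _ ≤ star (φ ↑b⁻¹) * φ (L + algebraMap ℝ D ε) * φ ↑b⁻¹ := by
        refine star_left_conjugate_le_conjugate ?_ _
        exact OrderHomClass.mono φ (le_add_of_nonneg_right (algebraMap_nonneg D hε.le))
    _ = 1 := by
        rw [hb, ← map_star, ← map_mul, ← map_mul, mul_assoc, mul_assoc, b.mul_inv, mul_one,
          ← star_mul, b.mul_inv, star_one, map_one]

lemma norm_sq_map_apply_of_star_mul_self_eq_add {D H : Type*} [CStarAlgebra D]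
    [NormedAddCommGroup H] [InnerProductSpace ℂ H] [CompleteSpace H] (ψ : D →⋆ₐ[ℂ] (H →L[ℂ] H))
    {b L : D} {ε : ℝ} (hb : star b * b = L + algebraMap ℝ D ε) (f : H) :
    ‖ψ b f‖ ^ 2 = (⟪f, ψ L f⟫_ℂ).re + ε * ‖f‖ ^ 2 := by
  have hnorm : ‖ψ b f‖ ^ 2 = (⟪f, ψ (star b * b) f⟫_ℂ).re := by
    rw [map_mul, map_star, ContinuousLinearMap.star_eq_adjoint, mul_apply_eq_comp,
      ContinuousLinearMap.adjoint_inner_right]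
    exact (inner_self_eq_norm_sq (𝕜 := ℂ) _).symm
  have hε : (⟪f, ψ (algebraMap ℝ D ε) f⟫_ℂ).re = ε * ‖f‖ ^ 2 := by
    rw [IsScalarTower.algebraMap_apply ℝ ℂ D, AlgHomClass.commutes, Complex.coe_algebraMap,
      Algebra.algebraMap_eq_smul_one, smul_apply, one_apply_eq_self, inner_smul_right,
      Complex.re_ofReal_mul]
    exact congrArg _ (inner_self_eq_norm_sq (𝕜 := ℂ) f)
  rw [hnorm, hb, map_add, add_apply, inner_add_right, Complex.add_re, hε]

variable {A : Type*} [CStarAlgebra A] [PartialOrder A] [StarOrderedRing A]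
  {K : Type*} [NormedAddCommGroup K] [InnerProductSpace ℂ K] [CompleteSpace K]
  {E : Submodule ℂ A} {u : E →ₗ[ℂ] (K →L[ℂ] K)} {n : ℕ}

variable (K n) in
/-- The operator on the Hilbert sum `K^n` with a given scalar matrix. -/
def scalarOperator : CStarMatrix (Fin n) (Fin n) ℂ →⋆ₐ[ℂ]
    (PiLp 2 (fun _ : Fin n => K) →L[ℂ] PiLp 2 (fun _ : Fin n => K)) :=
  (operatorMatrix (Fin n) K).comp (scalarMatrix (Fin n) (K →L[ℂ] K))

lemma norm_inner_amplification_le (hu : cbNorm u ≤ 1) {x : matrixSpace E n}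
    {b c : (CStarMatrix (Fin n) (Fin n) ℂ)ˣ}
    (hx : ‖scalarMatrix (Fin n) A (star (b⁻¹ : (CStarMatrix (Fin n) (Fin n) ℂ)ˣ)) *
      (x : CStarMatrix (Fin n) (Fin n) A) *
      scalarMatrix (Fin n) A (c⁻¹ : (CStarMatrix (Fin n) (Fin n) ℂ)ˣ)‖ ≤ 1)
    (f g : PiLp 2 fun _ : Fin n => K) :
    ‖⟪f, operatorMatrix (Fin n) K (amplification u n x) g⟫_ℂ‖ ≤
      ‖scalarOperator K n b f‖ * ‖scalarOperator K n c g‖ := by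
  let z : matrixSpace E n :=
    ⟨_, mul_scalarMatrix_mem (scalarMatrix_mul_mem x.2 (star ↑b⁻¹)) ↑c⁻¹⟩
  have hz : ‖operatorMatrix (Fin n) K (amplification u n z)‖ ≤ 1 :=
    (norm_operatorMatrix _).trans_le (norm_amplification_le_one hu hx)
  have hxz : amplification u n x = star (scalarMatrix (Fin n) (K →L[ℂ] K) b) *
      amplification u n z * scalarMatrix (Fin n) (K →L[ℂ] K) c := by
    have hbz : amplification u n z = star (scalarMatrix (Fin n) (K →L[ℂ] K) ↑b⁻¹) *
        amplification u n x * scalarMatrix (Fin n) (K →L[ℂ] K) ↑c⁻¹ := by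
      rw [← map_star, ← amplification_scalarMatrix_mul, ← amplification_mul_scalarMatrix]
    rw [hbz, ← mul_assoc, ← mul_assoc, ← star_mul, ← map_mul, b.inv_mul, map_one, star_one,
      one_mul, mul_assoc, ← map_mul, c.inv_mul, map_one, mul_one]
  rw [hxz, map_mul, map_mul, map_star, mul_apply_eq_comp, mul_apply_eq_comp,
    ContinuousLinearMap.star_eq_adjoint, ContinuousLinearMap.adjoint_inner_right]
  refine (norm_inner_le_norm _ _).trans (mul_le_mul_of_nonneg_left ?_ (norm_nonneg _))
  exact (ContinuousLinearMap.le_of_opNorm_le _ hz _).trans_eq (one_mul _)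

/-- The case `L = M = 1` is the contractivity of `amplification u n`, and rescaling reduces the
general case to it. -/
lemma re_inner_amplification_nonneg [Nontrivial A] (hu : cbNorm u ≤ 1) {κ : Type*} [Fintype κ]
    {P Q : κ → CStarMatrix (Fin n) (Fin n) A} {L M : CStarMatrix (Fin n) (Fin n) ℂ}
    (hP : ∑ k, star (P k) * P k = scalarMatrix (Fin n) A L)
    (hQ : ∑ k, star (Q k) * Q k = scalarMatrix (Fin n) A M) {x : matrixSpace E n}
    (hx : (x : CStarMatrix (Fin n) (Fin n) A) = ∑ k, star (P k) * Q k)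
    (f g : PiLp 2 fun _ : Fin n => K) :
    0 ≤ (⟪f, scalarOperator K n L f⟫_ℂ).re + (⟪g, scalarOperator K n M g⟫_ℂ).re +
      2 * (⟪f, operatorMatrix (Fin n) K (amplification u n x) g⟫_ℂ).re := by
  set S := (⟪f, scalarOperator K n L f⟫_ℂ).re + (⟪g, scalarOperator K n M g⟫_ℂ).re +
    2 * (⟪f, operatorMatrix (Fin n) K (amplification u n x) g⟫_ℂ).re
  suffices h : ∀ ε > 0, 0 ≤ S + ε * (‖f‖ ^ 2 + ‖g‖ ^ 2) by
    have hcont : Continuous fun ε : ℝ => S + ε * (‖f‖ ^ 2 + ‖g‖ ^ 2) := by fun_prop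
    simpa using ge_of_tendsto (hcont.continuousWithinAt (s := Set.Ioi 0) (x := 0)).tendsto
      (eventually_mem_nhdsWithin.mono h)
  intro ε hε
  obtain ⟨b, hb, hPb⟩ := exists_unit_star_mul_self_eq_add
    (φ := scalarMatrix (Fin n) A) scalarMatrix_injective hP hε
  obtain ⟨c, hc, hQc⟩ := exists_unit_star_mul_self_eq_add
    (φ := scalarMatrix (Fin n) A) scalarMatrix_injective hQ hε
  have hz : ‖scalarMatrix (Fin n) A (star (b⁻¹ : (CStarMatrix (Fin n) (Fin n) ℂ)ˣ)) *
      (x : CStarMatrix (Fin n) (Fin n) A) *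
      scalarMatrix (Fin n) A (c⁻¹ : (CStarMatrix (Fin n) (Fin n) ℂ)ˣ)‖ ≤ 1 := by
    refine (congrArg norm ?_).trans_le (norm_sum_star_mul_le_one hPb hQc)
    simp only [hx, Finset.mul_sum, Finset.sum_mul, star_mul, mul_assoc, map_star]
  have hf := norm_sq_map_apply_of_star_mul_self_eq_add (scalarOperator K n) hb f
  have hg := norm_sq_map_apply_of_star_mul_self_eq_add (scalarOperator K n) hc g
  have hfg := (abs_le.mp ((Complex.abs_re_le_norm _).trans
    (norm_inner_amplification_le hu hz f g))).1
  nlinarith [sq_nonneg (‖scalarOperator K n b f‖ - ‖scalarOperator K n c g‖)]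

end ScalarGram

section Gram

lemma cstarMatrix_sum_apply {κ m n A : Type*} [AddCommMonoid A] (s : Finset κ)
    (f : κ → CStarMatrix m n A) (i : m) (j : n) : (∑ k ∈ s, f k) i j = ∑ k ∈ s, f k i j :=
  Matrix.sum_apply i j s f

/- Stated for abstract algebras because the functional calculus of the concrete `CStarMatrix ι ι A`
is not found by instance search. -/
lemma exists_eq_star_mul_self_of_nonneg {C : Type*} [NonUnitalCStarAlgebra C] [PartialOrder C]
    [StarOrderedRing C] {x : C} (hx : 0 ≤ x) : ∃ r, x = star r * r :=
  CStarAlgebra.nonneg_iff_eq_star_mul_self.mp hx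

lemma exists_gram {ι A : Type*} [Fintype ι] [CStarAlgebra A] [PartialOrder A] [StarOrderedRing A]
    {x : CStarMatrix ι ι A} (hx : 0 ≤ x) :
    ∃ r : ι → ι → A, ∀ i j, x i j = ∑ k, star (r k i) * r k j := by
  obtain ⟨r, rfl⟩ := exists_eq_star_mul_self_of_nonneg hx
  exact ⟨r, fun i j => by simp [CStarMatrix.mul_apply, CStarMatrix.star_apply]⟩

end Gram

section Paulsen

variable {X B K : Type*} [AddCommGroup X] [Module ℂ X] [CStarAlgebra B]
  [NormedAddCommGroup K] [InnerProductSpace ℂ K] [CompleteSpace K]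

/-- The map `((λ, μ), x) ↦ [[λ, v x], [0, μ]]`. For the inclusion `v` of an operator space its
range, together with the adjoints, is the Paulsen system. -/
def paulsenMap (v : X →ₗ[ℂ] B) : (ℂ × ℂ) × X →ₗ[ℂ] CStarMatrix (Fin 2) (Fin 2) B where
  toFun p := CStarMatrix.ofMatrix !![algebraMap ℂ B p.1.1, v p.2; 0, algebraMap ℂ B p.1.2]
  map_add' p q := by
    ext i j
    fin_cases i <;> fin_cases j <;> simp
  map_smul' c p := by
    ext i j
    fin_cases i <;> fin_cases j <;> simp [Algebra.smul_def]

lemma paulsenMap_one (v : X →ₗ[ℂ] B) : paulsenMap v ((1, 1), 0) = 1 := by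
  ext i j
  fin_cases i <;> fin_cases j <;> simp [paulsenMap]

lemma inner_paulsenMap (v : X →ₗ[ℂ] (K →L[ℂ] K)) (p : (ℂ × ℂ) × X)
    (g h : PiLp 2 fun _ : Fin 2 => K) :
    ⟪g, operatorMatrix (Fin 2) K (paulsenMap v p) h⟫_ℂ =
      ⟪g 0, algebraMap ℂ (K →L[ℂ] K) p.1.1 (h 0)⟫_ℂ + ⟪g 0, v p.2 (h 1)⟫_ℂ +
        ⟪g 1, algebraMap ℂ (K →L[ℂ] K) p.1.2 (h 1)⟫_ℂ := by
  simp [inner_operatorMatrix, paulsenMap]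

variable {A : Type*} [CStarAlgebra A] [PartialOrder A] [StarOrderedRing A]
  {E : Submodule ℂ A} {u : E →ₗ[ℂ] (K →L[ℂ] K)}

lemma isCompletelyAccretive_paulsenMap [Nontrivial A] (hu : cbNorm u ≤ 1) :
    IsCompletelyAccretive (paulsenMap E.subtype)
      ((operatorMatrix (Fin 2) K).toLinearMap ∘ₗ paulsenMap u) := by
  intro n q hq h
  obtain ⟨R, hR⟩ := exists_gram hq
  let P (a c : Fin 2) : CStarMatrix (Fin n) (Fin n) A :=
    CStarMatrix.ofMatrix (.of fun k i => R k i c a)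
  have hgram : ∀ a b i j, (∑ c, star (P a c) * P b c) i j =
      paulsenMap E.subtype (q i j) a b + star (paulsenMap E.subtype (q j i) b a) := by
    intro a b i j
    refine Eq.trans ?_ (congrFun₂ (hR i j) a b).symm
    rw [Fin.sum_univ_two, cstarMatrix_sum_apply]
    simp [CStarMatrix.mul_apply, CStarMatrix.star_apply, P, Finset.sum_add_distrib]
  let gram (l : Fin n → Fin n → ℂ) : CStarMatrix (Fin n) (Fin n) ℂ :=
    CStarMatrix.ofMatrix (.of fun i j => l i j + conj (l j i))
  let f (a : Fin 2) : PiLp 2 fun _ : Fin n => K := WithLp.toLp 2 fun i => h i a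
  have hherm : ∀ (l : Fin n → Fin n → ℂ) a,
      (⟪f a, scalarOperator K n (gram l) (f a)⟫_ℂ).re =
        2 * (∑ i, ∑ j, ⟪h i a, algebraMap ℂ (K →L[ℂ] K) (l i j) (h j a)⟫_ℂ).re := by
    intro l a
    rw [← re_sum_sum_inner_add_star]
    simp [scalarOperator, inner_operatorMatrix, scalarMatrix_apply, f, gram, ← algebraMap_star_comm]
  have hmain := re_inner_amplification_nonneg hu (P := P 0) (Q := P 1)
    (L := gram fun i j => (q i j).1.1) (M := gram fun i j => (q i j).1.2)
    (x := ⟨CStarMatrix.ofMatrix (.of fun i j => ((q i j).2 : A)), fun i j => (q i j).2.2⟩)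
    (by ext i j; simp [hgram, paulsenMap, scalarMatrix_apply, gram, ← algebraMap_star_comm])
    (by ext i j; simp [hgram, paulsenMap, scalarMatrix_apply, gram, ← algebraMap_star_comm])
    (by ext i j; simp [hgram, paulsenMap])
    (f 0) (f 1)
  rw [hherm, hherm, inner_operatorMatrix] at hmain
  have hsum : ∀ i j, ⟪h i, ((operatorMatrix (Fin 2) K).toLinearMap ∘ₗ paulsenMap u)
      (q i j) (h j)⟫_ℂ = _ := fun i j => inner_paulsenMap u (q i j) (h i) (h j)
  simp only [hsum, Finset.sum_add_distrib, Complex.add_re]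
  change 0 ≤ _ + _ + 2 * (∑ i, ∑ j, ⟪h i 0, u (q i j).2 (h j 1)⟫_ℂ).re at hmain
  linarith

end Paulsen

section MatrixUnit

variable {ι : Type*} [DecidableEq ι] {A : Type*} [CStarAlgebra A]

variable (A) in
/-- The matrix unit `e_ij` of `M_ι(A)`. -/
def matrixUnit (i j : ι) : CStarMatrix ι ι A :=
  CStarMatrix.ofMatrix (Matrix.single i j 1)

lemma star_matrixUnit (i j : ι) : star (matrixUnit A i j) = matrixUnit A j i :=
  (Matrix.conjTranspose_single i j 1).trans (congrArg (Matrix.single j i) (star_one A))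

variable [Fintype ι]

variable (ι A) in
/-- The embedding of `A` into `M_ι(A)` as the multiples of the identity matrix. -/
def diagonalMatrix : A →⋆ₐ[ℂ] CStarMatrix ι ι A where
  toFun a := CStarMatrix.ofMatrix (Matrix.diagonal fun _ => a)
  map_zero' := Matrix.diagonal_zero
  map_one' := Matrix.diagonal_one
  map_add' _ _ := (Matrix.diagonal_add _ _).symm
  map_mul' _ _ := (Matrix.diagonal_mul_diagonal _ _).symm
  commutes' _ := rfl
  map_star' _ := (Matrix.diagonal_conjTranspose _).symm

lemma matrixUnit_mul_matrixUnit (i j k : ι) :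
    matrixUnit A i j * matrixUnit A j k = matrixUnit A i k :=
  (Matrix.single_mul_single_same _ i j k _).trans (congrArg (Matrix.single i k) (mul_one 1))

lemma norm_matrixUnit_le [PartialOrder A] [StarOrderedRing A] (i j : ι) :
    ‖matrixUnit A i j‖ ≤ 1 := by
  have hproj : IsStarProjection (matrixUnit A j j) :=
    ⟨matrixUnit_mul_matrixUnit j j j, star_matrixUnit j j⟩
  refine (sq_le_one_iff₀ (norm_nonneg _)).mp ?_
  rw [sq, ← CStarRing.norm_star_mul_self, star_matrixUnit, matrixUnit_mul_matrixUnit]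
  exact hproj.norm_le

lemma matrixUnit_mul_diagonalMatrix_apply (i j k l : ι) (a : A) :
    (matrixUnit A i j * diagonalMatrix ι A a) k l = Matrix.single i j a k l := by
  refine (Matrix.mul_diagonal _ _ _ _).trans ?_
  simp [matrixUnit, Matrix.single_apply]

end MatrixUnit

/-- The inclusion of the `i`-th summand into the Hilbert sum `K^ι`. -/
def summandIsometry {ι : Type*} [Fintype ι] [DecidableEq ι] (K : Type*) [NormedAddCommGroup K]
    [InnerProductSpace ℂ K] (i : ι) : K →ₗᵢ[ℂ] PiLp 2 (fun _ : ι => K) where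
  toFun k := PiLp.single 2 i k
  map_add' _ _ := PiLp.single_add _ _
  map_smul' c k := by
    ext j
    simp
  norm_map' _ := PiLp.norm_single _ _ _ _

section Factorization

variable {A : Type uA} [CStarAlgebra A] [PartialOrder A] [StarOrderedRing A]
  {K : Type uK} [NormedAddCommGroup K] [InnerProductSpace ℂ K] [CompleteSpace K]
  {E : Submodule ℂ A} {u : E →ₗ[ℂ] (K →L[ℂ] K)}

theorem exists_factorization_of_cbNorm_le_one_of_nontrivial [Nontrivial A] (hu : cbNorm u ≤ 1) :
    ∃ (H : Type (max uA uK w)) (_ : NormedAddCommGroup H) (_ : InnerProductSpace ℂ H)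
      (_ : CompleteSpace H) (π : A →⋆ₐ[ℂ] (H →L[ℂ] H)) (V W : K →L[ℂ] H),
      ‖V‖ ≤ 1 ∧ ‖W‖ ≤ 1 ∧ ∀ a : E, u a = V.adjoint ∘L π (a : A) ∘L W := by
  obtain ⟨H, _, _, _, π, V, hV, hπ⟩ := IsCompletelyAccretive.exists_dilation.{uA, uK, w}
    (isCompletelyAccretive_paulsenMap hu) (paulsenMap_one _)
  have hone : ((operatorMatrix (Fin 2) K).toLinearMap ∘ₗ paulsenMap u) ((1, 1), 0) = 1 :=
    (congrArg (operatorMatrix (Fin 2) K) (paulsenMap_one u)).trans (map_one _)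
  rw [hone] at hV
  have hV_one : ‖V‖ ≤ 1 :=
    hV.trans (Real.sqrt_le_one.mpr ContinuousLinearMap.norm_id_le)
  let ι (i : Fin 2) : K →L[ℂ] PiLp 2 (fun _ : Fin 2 => K) :=
    (summandIsometry K i).toContinuousLinearMap
  have hι : ∀ i, ‖V ∘L ι i‖ ≤ 1 := fun i =>
    (ContinuousLinearMap.opNorm_comp_le _ _).trans
      (mul_le_one₀ hV_one (norm_nonneg _) (LinearIsometry.norm_toContinuousLinearMap_le _))
  let e := matrixUnit A (0 : Fin 2) 1
  have he : ∀ a : E, e * diagonalMatrix (Fin 2) A a = paulsenMap E.subtype (0, a) := fun a => by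
    ext i j
    rw [matrixUnit_mul_diagonalMatrix_apply]
    fin_cases i <;> fin_cases j <;> simp [paulsenMap]
  have hπe : ‖(π e).adjoint‖ ≤ 1 := by
    rw [LinearIsometryEquiv.norm_map]
    exact (NonUnitalStarAlgHom.norm_apply_le π e).trans (norm_matrixUnit_le 0 1)
  refine ⟨H, inferInstance, inferInstance, inferInstance, π.comp (diagonalMatrix (Fin 2) A),
    (π e).adjoint ∘L V ∘L ι 0, V ∘L ι 1, (ContinuousLinearMap.opNorm_comp_le _ _).trans
      (mul_le_one₀ hπe (norm_nonneg _) (hι 0)), hι 1, fun a => ?_⟩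
  ext l
  refine ext_inner_left ℂ fun k => ?_
  calc ⟪k, u a l⟫_ℂ = ⟪ι 0 k, operatorMatrix (Fin 2) K (paulsenMap u (0, a)) (ι 1 l)⟫_ℂ := by
        rw [inner_paulsenMap]
        simp [ι, summandIsometry]
    _ = ⟪ι 0 k, (V.adjoint ∘L (π e * π (diagonalMatrix (Fin 2) A a)) ∘L V) (ι 1 l)⟫_ℂ := by
        rw [← map_mul, he, ← hπ]
        rfl
    _ = _ := by
        simp [ContinuousLinearMap.adjoint_inner_right, ContinuousLinearMap.adjoint_comp]

theorem exists_factorization_of_cbNorm_le_one (hu : cbNorm u ≤ 1) :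
    ∃ (H : Type (max uA uK w)) (_ : NormedAddCommGroup H) (_ : InnerProductSpace ℂ H)
      (_ : CompleteSpace H) (π : A →⋆ₐ[ℂ] (H →L[ℂ] H)) (V W : K →L[ℂ] H),
      ‖V‖ ≤ 1 ∧ ‖W‖ ≤ 1 ∧ ∀ a : E, u a = V.adjoint ∘L π (a : A) ∘L W := by
  cases subsingleton_or_nontrivial A
  · have h : IsCompletelyAccretive E.subtype u := fun n q _ h => by
      simp [Subsingleton.elim (q _ _) 0]
    obtain ⟨H, i₁, i₂, i₃, π, V, hV, hπ⟩ :=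
      IsCompletelyAccretive.exists_dilation.{uA, uK, w} h (q₁ := 0) (Subsingleton.elim _ _)
    have hV_one : ‖V‖ ≤ 1 := hV.trans (by simp)
    exact ⟨H, i₁, i₂, i₃, π, V, V, hV_one, hV_one, hπ⟩
  · exact exists_factorization_of_cbNorm_le_one_of_nontrivial hu

end Factorization

end

theorem mainTheorem1_general
    {A : Type uA} [CStarAlgebra A] [PartialOrder A] [StarOrderedRing A]
    {K : Type uK} [NormedAddCommGroup K] [InnerProductSpace ℂ K] [CompleteSpace K]
    (E : Submodule ℂ A) (u : E →ₗ[ℂ] (K →L[ℂ] K)) :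
    ((IsCompletelyBounded u ∧ cbNorm u ≤ 1) ↔
      ∃ (H : Type (max uA uK w)) (_ : NormedAddCommGroup H) (_ : InnerProductSpace ℂ H)
        (_ : CompleteSpace H) (π : A →⋆ₐ[ℂ] (H →L[ℂ] H)) (V W : K →L[ℂ] H),
        ‖V‖ ≤ 1 ∧ ‖W‖ ≤ 1 ∧ ∀ a : E, u a = V.adjoint ∘L π (a : A) ∘L W) ∧
    (1 ∈ E → (∀ x ∈ E, star x ∈ E) →
      (IsCompletelyPositive u ↔
        ∃ (H : Type (max uA uK w)) (_ : NormedAddCommGroup H) (_ : InnerProductSpace ℂ H)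
          (_ : CompleteSpace H) (π : A →⋆ₐ[ℂ] (H →L[ℂ] H)) (V : K →L[ℂ] H),
          ∀ a : E, u a = V.adjoint ∘L π (a : A) ∘L V) ∧
      ((IsCompletelyPositive u ∧ cbNorm u ≤ 1) ↔
        ∃ (H : Type (max uA uK w)) (_ : NormedAddCommGroup H) (_ : InnerProductSpace ℂ H)
          (_ : CompleteSpace H) (π : A →⋆ₐ[ℂ] (H →L[ℂ] H)) (V : K →L[ℂ] H),
          ‖V‖ ≤ 1 ∧ ∀ a : E, u a = V.adjoint ∘L π (a : A) ∘L V)) := by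
  refine ⟨⟨fun h => exists_factorization_of_cbNorm_le_one h.2, ?_⟩, fun hone hstar =>
    ⟨⟨fun h => ?_, ?_⟩, fun h => ?_, ?_⟩⟩
  · rintro ⟨H, _, _, _, π, V, W, hV, hW, hu⟩
    have hcb := cbNorm_le_one_of_factorization hV hW hu
    exact ⟨hcb.trans_lt ENNReal.one_lt_top, hcb⟩
  · obtain ⟨H, i₁, i₂, i₃, π, V, -, hu⟩ := h.exists_dilation hone hstar
    exact ⟨H, i₁, i₂, i₃, π, V, hu⟩
  · rintro ⟨H, _, _, _, π, V, hu⟩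
    exact isCompletelyPositive_of_factorization hu
  · obtain ⟨H, i₁, i₂, i₃, π, V, hV, hu⟩ := h.1.exists_dilation hone hstar
    exact ⟨H, i₁, i₂, i₃, π, V,
      hV.trans (Real.sqrt_le_one.mpr (norm_apply_one_le_one h.2 hone)), hu⟩
  · rintro ⟨H, _, _, _, π, V, hV, hu⟩
    exact ⟨isCompletelyPositive_of_factorization hu, cbNorm_le_one_of_factorization hV hV hu⟩

theorem mainTheorem1
    {A : Type uA} [CStarAlgebra A] [PartialOrder A] [StarOrderedRing A]
    {K : Type uK} [NormedAddCommGroup K] [InnerProductSpace ℂ K] [CompleteSpace K]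
    (E : Submodule ℂ A) (hE : IsOperatorSpace E) (u : E →ₗ[ℂ] (K →L[ℂ] K)) :
    ((IsCompletelyBounded u ∧ cbNorm u ≤ 1) ↔
      ∃ (H : Type (max uA uK w)) (_ : NormedAddCommGroup H) (_ : InnerProductSpace ℂ H)
        (_ : CompleteSpace H) (π : A →⋆ₐ[ℂ] (H →L[ℂ] H)) (V W : K →L[ℂ] H),
        ‖V‖ ≤ 1 ∧ ‖W‖ ≤ 1 ∧
          ∀ a : E, u a = (ContinuousLinearMap.adjoint V).comp ((π (a : A)).comp W)) ∧
    (IsOperatorSystem E →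
      (IsCompletelyPositive u ↔
        ∃ (H : Type (max uA uK w)) (_ : NormedAddCommGroup H) (_ : InnerProductSpace ℂ H)
          (_ : CompleteSpace H) (π : A →⋆ₐ[ℂ] (H →L[ℂ] H)) (V : K →L[ℂ] H),
          ∀ a : E, u a = (ContinuousLinearMap.adjoint V).comp ((π (a : A)).comp V)) ∧
      ((IsCompletelyPositive u ∧ cbNorm u ≤ 1) ↔
        ∃ (H : Type (max uA uK w)) (_ : NormedAddCommGroup H) (_ : InnerProductSpace ℂ H)
          (_ : CompleteSpace H) (π : A →⋆ₐ[ℂ] (H →L[ℂ] H)) (V : K →L[ℂ] H),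
          ‖V‖ ≤ 1 ∧
            ∀ a : E, u a = (ContinuousLinearMap.adjoint V).comp ((π (a : A)).comp V))) := by
  have h := mainTheorem1_general.{uA, uK, w} E u
  exact ⟨h.1, fun hS => h.2 hS.one_mem hS.star_mem⟩
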